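/- Let $(X_i)_{i\ge 1}$ be independent discrete random variables on a common probability space, all with the same law $P=[p_1,\dots,p_k]$ on a finite set of $k$ outcomes. For probability vectors $Q=[q_1,\dots,q_k]$ and $P$ put (with $0\log 0=0$) $$H(P)=-\sum_{j=1}^k p_j\log p_j,\qquad H(Q,P)=-\sum_{j=1}^k q_j\log p_j,\qquad V_I(P)=\sum_{j=1}^k p_j\bigl(-\log p_j-H(P)\bigr)^2,$$ $$D_S(Q\|P)=\frac{H(Q,P)-H(P)}{\sqrt{V_I(P)}},$$ and assume $V_I(P)>0$, so that $D_S(\cdot\|P)$ is defined. For $n\ge 1$ let $\hat P_n$ be the maximum likelihood estimate of $P$ from $X_1,\dots,X_n$, that is, the probability vector $Q$ that maximizes the likelihood of the sample (the product over $i=1,\dots,n$ of the probability that $Q$ gives to the outcome $X_i$). For every sample of size $n\ge1$ this maximizer exists, is unique, and is the empirical distribution (the vector of relative frequencies of the $k$ outcomes in the sample). Then $$\sqrt n\, D_S(\hat P_n\|P)\xrightarrow{d} N(0,1)\qquad (n\to\infty).$$ -/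

import Mathlib

open MeasureTheory ProbabilityTheory Filter

namespace SurpriseDivergence

noncomputable section

/-- Cross entropy `H(Q,P) = -∑ q_a log p_a` (natural logarithm). The convention `Real.log 0 = 0`
implements `0 log 0 = 0`; a term with `p a = 0 < q a` occurs for an estimate `q` computed from a
sample of law `p` only on an event of probability zero. -/
def crossEntropy {α : Type*} [Fintype α] (q p : α → ℝ) : ℝ :=
  -∑ a, q a * Real.log (p a)

/-- Shannon entropy `H(P) = -∑ p_a log p_a`. -/
def entropy {α : Type*} [Fintype α] (p : α → ℝ) : ℝ :=
  -∑ a, p a * Real.log (p a)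

/-- Information dispersion `V_I(P) = E_P[(-log P(X) - H(P))^2]`. -/
def infoDispersion {α : Type*} [Fintype α] (p : α → ℝ) : ℝ :=
  ∑ a, p a * (-Real.log (p a) - entropy p) ^ 2

/-- Surprise divergence `D_S(Q‖P) = (H(Q,P) - H(P)) / √V_I(P)`. -/
def surpriseDiv {α : Type*} [Fintype α] (q p : α → ℝ) : ℝ :=
  (crossEntropy q p - entropy p) / Real.sqrt (infoDispersion p)

/-- Likelihood of the probability vector `q` given the sample `x` of size `n`. -/
def likelihood {α : Type*} {n : ℕ} (x : Fin n → α) (q : α → ℝ) : ℝ :=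
  ∏ i, q (x i)

/-- `q` is a maximum likelihood estimate from the sample `x`: a probability vector which maximizes
the likelihood among all probability vectors. -/
def IsMLE {α : Type*} [Fintype α] {n : ℕ} (x : Fin n → α) (q : α → ℝ) : Prop :=
  q ∈ stdSimplex ℝ α ∧ ∀ r ∈ stdSimplex ℝ α, likelihood x r ≤ likelihood x q

/-- The vector of relative frequencies in the sample `x`. -/
def empirical {α : Type*} [DecidableEq α] {n : ℕ} (x : Fin n → α) (a : α) : ℝ :=
  ((Finset.univ.filter (fun i => x i = a)).card : ℝ) / (n : ℝ)

end

end SurpriseDivergence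

/-!
The first assertion is Gibbs' inequality. With `e` the empirical distribution of the sample `x` and
`r` any probability vector, the ratios `t i = r (x i) / e (x i)` satisfy `t i ≤ exp (t i - 1)`, with
equality only at `t i = 1`, and `∑ i, (t i - 1) ≤ 0`. Hence the likelihood ratio `∏ i, t i` is at
most `1`, and it equals `1` only if `r` agrees with `e` on the outcomes of the sample; since `e`
already carries mass `1` there, this means `r = e` (`likelihood_le_likelihood_empirical`,
`eq_empirical_of_likelihood_le`).

For the second assertion, `H(Q, P)` is linear in `Q`, so at the empirical distribution it is the
sample mean of the surprises `-log p (X i)` (`sum_empirical_mul`). Thus `√n` times the surprise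
divergence is exactly the normalized sum of the standardized surprises (`sqrt_mul_surpriseDiv`),
which are i.i.d. with mean `0` and variance `1`, and the central limit theorem applies.
-/

namespace SurpriseDivergence

/-! ### The empirical distribution -/

section Empirical

variable {α : Type*} [DecidableEq α] {n : ℕ}

lemma empirical_nonneg (x : Fin n → α) (a : α) : 0 ≤ empirical x a := by
  unfold empirical; positivity

lemma empirical_apply_pos (x : Fin n → α) (i : Fin n) : 0 < empirical x (x i) := by
  have hn : 0 < n := i.pos
  have : 0 < (Finset.univ.filter (fun j => x j = x i)).card :=
    Finset.card_pos.2 ⟨i, by simp⟩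
  unfold empirical; positivity

/-- The mean of `g` under the empirical distribution is the sample mean of `g`. For `n = 0` both
sides vanish, by division by zero. -/
lemma sum_empirical_mul [Fintype α] (x : Fin n → α) (g : α → ℝ) :
    ∑ a, empirical x a * g a = (∑ i, g (x i)) / n := by
  have h (a : α) : empirical x a * g a = (∑ i, if x i = a then g a else 0) / n := by
    rw [← Finset.sum_filter, Finset.sum_const, nsmul_eq_mul, empirical]
    ring
  simp_rw [h]
  rw [← Finset.sum_div, Finset.sum_comm]
  simp

lemma empirical_mem_stdSimplex [Fintype α] (hn : 1 ≤ n) (x : Fin n → α) :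
    empirical x ∈ stdSimplex ℝ α := by
  refine ⟨empirical_nonneg x, ?_⟩
  have hn' : (n : ℝ) ≠ 0 := by positivity
  simpa [hn'] using sum_empirical_mul x (fun _ => 1)

/-! ### Maximum likelihood -/

lemma sum_div_empirical_sub_one_nonpos [Fintype α] (x : Fin n → α) {r : α → ℝ}
    (hr : r ∈ stdSimplex ℝ α) : ∑ i, (r (x i) / empirical x (x i) - 1) ≤ 0 := by
  rcases Nat.eq_zero_or_pos n with rfl | hn
  · simp
  have hn' : (0 : ℝ) < n := by positivity
  have h := sum_empirical_mul x (fun a => r a / empirical x a)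
  have hle : ∑ a, empirical x a * (r a / empirical x a) ≤ 1 := by
    rw [← hr.2]
    refine Finset.sum_le_sum fun a _ => ?_
    rcases eq_or_ne (empirical x a) 0 with h0 | h0
    · simpa [h0] using hr.1 a
    · rw [mul_div_cancel₀ _ h0]
  rw [h, div_le_one hn'] at hle
  simpa using hle

lemma likelihood_eq_prod_mul (x : Fin n → α) (r : α → ℝ) :
    likelihood x r =
      (∏ i, r (x i) / empirical x (x i)) * likelihood x (empirical x) := by
  rw [likelihood, likelihood, ← Finset.prod_mul_distrib]
  exact Finset.prod_congr rfl fun i _ => (div_mul_cancel₀ _ (empirical_apply_pos x i).ne').symm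

lemma likelihood_empirical_pos (x : Fin n → α) : 0 < likelihood x (empirical x) :=
  Finset.prod_pos fun i _ => empirical_apply_pos x i

lemma likelihood_le_likelihood_empirical [Fintype α] (x : Fin n → α) {r : α → ℝ}
    (hr : r ∈ stdSimplex ℝ α) : likelihood x r ≤ likelihood x (empirical x) := by
  rw [likelihood_eq_prod_mul]
  refine mul_le_of_le_one_left (likelihood_empirical_pos x).le ?_
  calc ∏ i, r (x i) / empirical x (x i)
      ≤ ∏ i, Real.exp (r (x i) / empirical x (x i) - 1) :=
        Finset.prod_le_prod (fun i _ => div_nonneg (hr.1 _) (empirical_nonneg x _))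
          fun i _ => by linarith [Real.add_one_le_exp (r (x i) / empirical x (x i) - 1)]
    _ ≤ 1 := by
        rw [← Real.exp_sum, Real.exp_le_one_iff]
        exact sum_div_empirical_sub_one_nonpos x hr

/-- The empirical distribution is the only maximizer of the likelihood. -/
lemma eq_empirical_of_likelihood_le [Fintype α] (hn : 1 ≤ n) (x : Fin n → α) {r : α → ℝ}
    (hr : r ∈ stdSimplex ℝ α) (h : likelihood x (empirical x) ≤ likelihood x r) :
    r = empirical x := by
  rw [likelihood_eq_prod_mul x r, le_mul_iff_one_le_left (likelihood_empirical_pos x)] at h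
  have hpos (i : Fin n) : 0 < r (x i) / empirical x (x i) := by
    refine (div_nonneg (hr.1 _) (empirical_nonneg x _)).lt_of_ne' fun h0 => ?_
    rw [Finset.prod_eq_zero (Finset.mem_univ i) h0] at h
    norm_num at h
  have hone (i : Fin n) : r (x i) / empirical x (x i) = 1 := by
    by_contra hi
    have hlt : ∏ i, r (x i) / empirical x (x i)
        < ∏ i, Real.exp (r (x i) / empirical x (x i) - 1) :=
      Finset.prod_lt_prod (fun i _ => hpos i)
        (fun i _ => by linarith [Real.add_one_le_exp (r (x i) / empirical x (x i) - 1)])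
        ⟨i, Finset.mem_univ i, by linarith [Real.add_one_lt_exp (sub_ne_zero.2 hi)]⟩
    rw [← Real.exp_sum] at hlt
    have := Real.exp_le_one_iff.2 (sum_div_empirical_sub_one_nonpos x hr)
    linarith
  -- Off the sample `empirical x` vanishes, so `empirical x ≤ r` everywhere, and both sum to `1`.
  have hle : ∀ a ∈ Finset.univ, empirical x a ≤ r a := by
    intro a _
    by_cases ha : ∃ i, x i = a
    · obtain ⟨i, rfl⟩ := ha
      exact ((div_eq_one_iff_eq (empirical_apply_pos x i).ne').1 (hone i)).ge
    · have : empirical x a = 0 := by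
        simp [empirical, Finset.filter_eq_empty_iff.2 fun i _ hi => ha ⟨i, hi⟩]
      exact this ▸ hr.1 a
  have hsum : ∑ a, empirical x a = ∑ a, r a := by
    rw [hr.2, (empirical_mem_stdSimplex hn x).2]
  funext a
  exact ((Finset.sum_eq_sum_iff_of_le hle).1 hsum a (Finset.mem_univ a)).symm

lemma isMLE_iff_eq_empirical [Fintype α] (hn : 1 ≤ n) (x : Fin n → α) (q : α → ℝ) :
    IsMLE x q ↔ q = empirical x := by
  constructor
  · rintro ⟨hq, hmax⟩
    exact eq_empirical_of_likelihood_le hn x hq (hmax _ (empirical_mem_stdSimplex hn x))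
  · rintro rfl
    exact ⟨empirical_mem_stdSimplex hn x, fun _ hr => likelihood_le_likelihood_empirical x hr⟩

end Empirical

/-! ### Standardized surprises -/

/-- The surprise `-log p a` of the outcome `a`, centered at the entropy and divided by the square
root of the information dispersion. -/
noncomputable def stdSurprise {α : Type*} [Fintype α] (p : α → ℝ) (a : α) : ℝ :=
  (-Real.log (p a) - entropy p) / Real.sqrt (infoDispersion p)

section StdSurprise

variable {α : Type*} [Fintype α]

lemma sum_mul_stdSurprise {p : α → ℝ} (hp : ∑ a, p a = 1) : ∑ a, p a * stdSurprise p a = 0 := by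
  simp_rw [stdSurprise, ← mul_div_assoc]
  rw [← Finset.sum_div]
  simp_rw [mul_sub]
  rw [Finset.sum_sub_distrib, ← Finset.sum_mul, hp]
  simp [entropy]

lemma sum_mul_stdSurprise_sq {p : α → ℝ} (hV : 0 < infoDispersion p) :
    ∑ a, p a * stdSurprise p a ^ 2 = 1 := by
  simp_rw [stdSurprise, div_pow, Real.sq_sqrt hV.le, ← mul_div_assoc]
  rw [← Finset.sum_div]
  exact div_self hV.ne'

lemma sqrt_mul_surpriseDiv [DecidableEq α] {n : ℕ} (hn : 1 ≤ n) (x : Fin n → α) (p : α → ℝ) :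
    Real.sqrt n * surpriseDiv (empirical x) p = (Real.sqrt n)⁻¹ * ∑ i, stdSurprise p (x i) := by
  have hn' : (0 : ℝ) < n := by positivity
  have hs : Real.sqrt n * Real.sqrt n = n := Real.mul_self_sqrt hn'.le
  have hs0 : Real.sqrt n ≠ 0 := (Real.sqrt_pos.2 hn').ne'
  simp_rw [stdSurprise, ← Finset.sum_div]
  rw [surpriseDiv, crossEntropy, sum_empirical_mul x (fun a => Real.log (p a)),
    Finset.sum_sub_distrib, Finset.sum_neg_distrib, Finset.sum_const, Finset.card_univ,
    Fintype.card_fin, nsmul_eq_mul, ← mul_div_assoc, ← mul_div_assoc]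
  congr 1
  rw [eq_inv_mul_iff_mul_eq₀ hs0, ← mul_assoc, hs]
  field_simp

end StdSurprise

/-! ### Finitely valued random variables -/

section Law

variable {α : Type*} [Fintype α] [MeasurableSpace α] [MeasurableSingletonClass α]
  {Ω : Type*} [MeasurableSpace Ω] {μ : Measure Ω} [IsFiniteMeasure μ]

lemma integral_comp_eq_sum {Y : Ω → α} (hY : Measurable Y) {p : α → ℝ}
    (hp : ∀ a, μ.real {ω | Y ω = a} = p a) (g : α → ℝ) :
    ∫ ω, g (Y ω) ∂μ = ∑ a, p a * g a := by
  rw [← integral_map (μ := μ) (φ := Y) (f := g) hY.aemeasurable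
    (measurable_of_finite g).aestronglyMeasurable, integral_fintype Integrable.of_finite]
  refine Finset.sum_congr rfl fun a _ => ?_
  rw [map_measureReal_apply hY (measurableSet_singleton a), ← hp a, smul_eq_mul]
  rfl

lemma identDistrib_of_measureReal_eq {Y Z : Ω → α} (hY : Measurable Y) (hZ : Measurable Z)
    (h : ∀ a, μ.real {ω | Y ω = a} = μ.real {ω | Z ω = a}) : IdentDistrib Y Z μ μ := by
  refine ⟨hY.aemeasurable, hZ.aemeasurable, Measure.ext_of_singleton fun a => ?_⟩
  rw [Measure.map_apply hY (measurableSet_singleton a),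
    Measure.map_apply hZ (measurableSet_singleton a)]
  exact (measureReal_eq_measureReal_iff).1 (h a)

end Law

end SurpriseDivergence

theorem mainTheorem1 {α : Type*} [Fintype α] [DecidableEq α]
    [MeasurableSpace α] [MeasurableSingletonClass α]
    {Ω : Type*} [MeasurableSpace Ω] (μ : Measure Ω) [IsProbabilityMeasure μ]
    (X : ℕ → Ω → α) (hX : ∀ i, Measurable (X i)) (hindep : iIndepFun X μ)
    (p : α → ℝ) (hp : ∀ i a, μ.real {ω | X i ω = a} = p a)
    (hV : 0 < SurpriseDivergence.infoDispersion p) :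
    (∀ n : ℕ, 1 ≤ n → ∀ (x : Fin n → α) (q : α → ℝ),
      SurpriseDivergence.IsMLE x q ↔ q = SurpriseDivergence.empirical x) ∧
    ∀ Phat : ℕ → Ω → α → ℝ,
      (∀ n : ℕ, 1 ≤ n → ∀ ω,
        SurpriseDivergence.IsMLE (fun i : Fin n => X i ω) (Phat n ω)) →
      TendstoInDistribution
        (fun (n : ℕ) ω => Real.sqrt n * SurpriseDivergence.surpriseDiv (Phat n ω) p)
        atTop (id : ℝ → ℝ) (fun _ => μ) (gaussianReal 0 1) := by
  open SurpriseDivergence in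
  refine ⟨fun n hn x q => isMLE_iff_eq_empirical hn x q, fun Phat hPhat => ?_⟩
  have hmeas : Measurable (stdSurprise p) := measurable_of_finite _
  have hp1 : ∑ a, p a = 1 := by
    simpa using (integral_comp_eq_sum (μ := μ) (hX 0) (hp 0) (fun _ => 1)).symm
  have hclt := tendstoInDistribution_inv_sqrt_mul_sum (P := μ) (P' := gaussianReal 0 1)
    (Y := (id : ℝ → ℝ)) (X := fun i ω => stdSurprise p (X i ω)) HasLaw.id
    ((integral_comp_eq_sum (hX 0) (hp 0) _).trans (sum_mul_stdSurprise hp1))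
    ((integral_comp_eq_sum (hX 0) (hp 0) fun a => stdSurprise p a ^ 2).trans
      (sum_mul_stdSurprise_sq hV))
    (hindep.comp (fun _ => stdSurprise p) fun _ => hmeas)
    (fun i => (identDistrib_of_measureReal_eq (hX i) (hX 0)
      fun a => (hp i a).trans (hp 0 a).symm).comp hmeas)
  refine hclt.congr (fun n => Eventually.of_forall fun ω => ?_) (Eventually.of_forall fun _ => rfl)
  -- `Phat 0` is arbitrary, but for `n = 0` both sides carry the factor `√0 = 0`.
  rcases Nat.eq_zero_or_pos n with rfl | hn
  · simp
  · have hq := (isMLE_iff_eq_empirical hn _ _).1 (hPhat n hn ω)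
    simp only [hq, sqrt_mul_surpriseDiv hn, Finset.sum_range]
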